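/- Let $q,r\ge 1$, let $P$ be a probability distribution on $\mathbb{R}^q$ and let $X_1,X_2,\dots$ be independent random vectors with distribution $P$. Let $f:\mathbb{R}^q\to\mathbb{R}^r$ be measurable with $\mathbb{E}\|f(X_1-X_2)\|^2<\infty$. Put $f^{\rm s}(x):=\tfrac12\bigl(f(x)+f(-x)\bigr)$, $f_0:=\mathbb{E} f(X_1-X_2)$, and for $x,y\in\mathbb{R}^q$ $$f_1(x):=\mathbb{E} f^{\rm s}(x-X_1)-f_0,\qquad f_2(x,y):=f^{\rm s}(x-y)-f_0-f_1(x)-f_1(y),$$ where the expectation defining $f_1(x)$ exists for $P$-almost every $x$ (on the remaining $P$-null set of $x$ it is set to $0$). Let $\Gamma_1:=\operatorname{Var}(f_1(X_1))$ and $\Gamma_2:=\operatorname{Var}(f_2(X_1,X_2))$ be the covariance matrices. For $n\ge1$ let $\hat P_n:=n^{-1}\sum_{i=1}^n\delta_{X_i}$ be the empirical distribution. Fix an integer $d\ge 1$ and, for $n\ge 2d+1$, let $$M_{n,d}:=(nd)^{-1}\sum_{i=1}^n\sum_{j=i+1}^{i+d} f_2(X_i,X_j),\qquad\text{where in these sums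 } X_{n+s}:=X_s\text{ for }1\le s\le n.$$ Then, as $n\to\infty$, the random pair $$\Bigl(\sqrt n\int_{\mathbb{R}^q} f_1\,d\hat P_n,\ \sqrt{nd}\,M_{n,d}\Bigr)$$ converges in distribution to $\mathcal N_r(0,\Gamma_1)\otimes\mathcal N_r(0,\Gamma_2)$, the product of the two (possibly degenerate) centered Gaussian distributions on $\mathbb{R}^r$ with covariance matrices $\Gamma_1$ and $\Gamma_2$. -/

import Mathlib

open MeasureTheory ProbabilityTheory Filter

namespace IncompleteU

noncomputable section

/-- The symmetrized kernel `fˢ(x) = (f(x) + f(-x)) / 2`. -/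
def symmKernel {q r : ℕ}
    (f : EuclideanSpace ℝ (Fin q) → EuclideanSpace ℝ (Fin r))
    (x : EuclideanSpace ℝ (Fin q)) : EuclideanSpace ℝ (Fin r) :=
  (2 : ℝ)⁻¹ • (f x + f (-x))

/-- `f₀ = E f(X₁ - X₂)` for independent `X₁, X₂` with distribution `P`. -/
def kernelMean {q r : ℕ} (P : Measure (EuclideanSpace ℝ (Fin q)))
    (f : EuclideanSpace ℝ (Fin q) → EuclideanSpace ℝ (Fin r)) : EuclideanSpace ℝ (Fin r) :=
  ∫ p, f (p.1 - p.2) ∂(P.prod P)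

/-- First-order Hoeffding term `f₁(x) = E fˢ(x - X₁) - f₀`. -/
def hoeffding₁ {q r : ℕ} (P : Measure (EuclideanSpace ℝ (Fin q)))
    (f : EuclideanSpace ℝ (Fin q) → EuclideanSpace ℝ (Fin r))
    (x : EuclideanSpace ℝ (Fin q)) : EuclideanSpace ℝ (Fin r) :=
  (∫ y, symmKernel f (x - y) ∂P) - kernelMean P f

/-- Second-order Hoeffding term `f₂(x, y) = fˢ(x - y) - f₀ - f₁(x) - f₁(y)`. -/
def hoeffding₂ {q r : ℕ} (P : Measure (EuclideanSpace ℝ (Fin q)))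
    (f : EuclideanSpace ℝ (Fin q) → EuclideanSpace ℝ (Fin r))
    (x y : EuclideanSpace ℝ (Fin q)) : EuclideanSpace ℝ (Fin r) :=
  symmKernel f (x - y) - kernelMean P f - hoeffding₁ P f x - hoeffding₁ P f y

/-- The covariance matrix of a random vector `Y` in `ℝʳ` under `μ`. -/
def covMatrix {r : ℕ} {S : Type*} [MeasurableSpace S]
    (Y : S → EuclideanSpace ℝ (Fin r)) (μ : Measure S) : Matrix (Fin r) (Fin r) ℝ :=
  Matrix.of fun a b => cov[fun s => Y s a, fun s => Y s b; μ]

/-- `Γ₁ = Var(f₁(X₁))`. -/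
def Γ₁ {q r : ℕ} (P : Measure (EuclideanSpace ℝ (Fin q)))
    (f : EuclideanSpace ℝ (Fin q) → EuclideanSpace ℝ (Fin r)) : Matrix (Fin r) (Fin r) ℝ :=
  covMatrix (hoeffding₁ P f) P

/-- `Γ₂ = Var(f₂(X₁, X₂))` for independent `X₁, X₂` with distribution `P`. -/
def Γ₂ {q r : ℕ} (P : Measure (EuclideanSpace ℝ (Fin q)))
    (f : EuclideanSpace ℝ (Fin q) → EuclideanSpace ℝ (Fin r)) : Matrix (Fin r) (Fin r) ℝ :=
  covMatrix (fun p : EuclideanSpace ℝ (Fin q) × EuclideanSpace ℝ (Fin q) =>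
    hoeffding₂ P f p.1 p.2) (P.prod P)

/-- The empirical distribution `n⁻¹ ∑ δ_{x i}` of the first `n` points of a sequence
(indexed from `0`). -/
def empiricalMeasure {q : ℕ} (n : ℕ) (x : ℕ → EuclideanSpace ℝ (Fin q)) :
    Measure (EuclideanSpace ℝ (Fin q)) :=
  (n : ENNReal)⁻¹ • ∑ i ∈ Finset.range n, Measure.dirac (x i)

/-- `M_{n,d} = (nd)⁻¹ ∑_i ∑_{j=i+1}^{i+d} f₂(x_i, x_j)`, where `i` runs through the first `n`
indices (here `0, …, n-1`) and indices `j` beyond the last one are read cyclically, modulo `n`. -/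
def incompleteRemainder {q r : ℕ} (P : Measure (EuclideanSpace ℝ (Fin q)))
    (f : EuclideanSpace ℝ (Fin q) → EuclideanSpace ℝ (Fin r)) (n d : ℕ)
    (x : ℕ → EuclideanSpace ℝ (Fin q)) : EuclideanSpace ℝ (Fin r) :=
  ((n : ℝ) * (d : ℝ))⁻¹ • ∑ i ∈ Finset.range n, ∑ j ∈ Finset.Icc (i + 1) (i + d),
    hoeffding₂ P f (x i) (x (j % n))

end

end IncompleteU

namespace IncompleteU

open scoped Topology RealInnerProductSpace Matrix

/-! By Lévy's continuity theorem it suffices to treat one projection `(t, u)` of the pair. With `g =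
⟪f₁, t⟫` and `h = d^(-1/2) ⟪f₂, u⟫` the projected statistic is `n^(-1/2)` times the sum over `i` of
the windows `g(X_i) + ∑_{j=i+1}^{i+d} h(X_i, X_j)`, indices taken cyclically.

Degeneracy of `h` and centering of `g` make any two distinct summands `g(X_i)`, `h(X_i, X_j)` (`i <
j`) orthogonal: one of them has an index that the other lacks, and integrating out that coordinate
gives zero (`integral_pairTerm_mul_of_ne`). So a sum of `m` distinct windows has variance exactly `m
v` with `v = E g² + d E h²`, although the windows are only `d`-dependent.

The limit theorem follows by blocks of fixed length `b + d`: keeping the first `b` windows of each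
block leaves i.i.d. block sums, handled by the Taylor expansion of their characteristic function;
the dropped windows carry a variance proportion of about `d / (b + d)`, so `n → ∞` is followed by `b
→ ∞` (`tendsto_charFun_windowSum`). Cyclic reading alters at most `d²` summands, an `L¹` error that
the factor `n^(-1/2)` kills.

Finally `v = tᵀ Γ₁ t + uᵀ Γ₂ u` (`windowVar_inner`). The absence of a mixed term is the asymptotic
independence of the two components. -/

/-- A centered function `g` and a completely degenerate kernel `h`, both square integrable. -/
structure DegeneratePair {E : Type*} [MeasurableSpace E] (P : Measure E)
    (g : E → ℝ) (h : E → E → ℝ) : Prop where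
  measurable_fst : Measurable g
  measurable_snd : Measurable (Function.uncurry h)
  memLp_fst : MemLp g 2 P
  memLp_snd : MemLp (Function.uncurry h) 2 (P.prod P)
  integral_fst : ∫ x, g x ∂P = 0
  integral_snd_left : ∀ᵐ y ∂P, ∫ x, h x y ∂P = 0
  integral_snd_right : ∀ᵐ x ∂P, ∫ y, h x y ∂P = 0

/-- The summand attached to a pair of indices: `g` on the diagonal and `h` off the diagonal. -/
def pairTerm {E : Type*} (g : E → ℝ) (h : E → E → ℝ) (p : ℕ × ℕ) (x : ℕ → E) : ℝ :=
  if p.1 = p.2 then g (x p.1) else h (x p.1) (x p.2)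

/-- Fubini on the product law of `(U, V)`, integrating over `U` first. -/
lemma integral_mul_eq_zero_of_indepFun {Ω E F : Type*} [MeasurableSpace Ω] [MeasurableSpace E]
    [MeasurableSpace F] {μ : Measure Ω} [IsProbabilityMeasure μ] {P : Measure E}
    [IsProbabilityMeasure P] {U : Ω → E} {V : Ω → F} (hU : HasLaw U P μ) (hV : Measurable V)
    (hUV : IndepFun U V μ) {H : E → F → ℝ} (hH : Measurable (Function.uncurry H))
    (h0 : ∀ᵐ v ∂(μ.map V), ∫ x, H x v ∂P = 0) {G : F → ℝ} (hG : Measurable G) :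
    ∫ ω, H (U ω) (V ω) * G (V ω) ∂μ = 0 := by
  have hlaw : μ.map (fun ω => (U ω, V ω)) = P.prod (μ.map V) := by
    rw [(indepFun_iff_map_prod_eq_prod_map_map hU.aemeasurable hV.aemeasurable).1 hUV, hU.map_eq]
  have : IsProbabilityMeasure (μ.map V) := Measure.isProbabilityMeasure_map hV.aemeasurable
  have hm : Measurable (fun p : E × F => H p.1 p.2 * G p.2) :=
    hH.mul (hG.comp measurable_snd)
  have h1 : ∫ ω, H (U ω) (V ω) * G (V ω) ∂μ
      = ∫ p, H p.1 p.2 * G p.2 ∂(P.prod (μ.map V)) := by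
    rw [← hlaw, integral_map (hU.aemeasurable.prodMk hV.aemeasurable) hm.aestronglyMeasurable]
  rw [h1]
  by_cases hi : Integrable (fun p : E × F => H p.1 p.2 * G p.2) (P.prod (μ.map V))
  · rw [integral_prod_symm _ hi]
    refine integral_eq_zero_of_ae ?_
    filter_upwards [h0] with v hv
    simp [integral_mul_const, hv]
  -- Without integrability the Bochner integral is zero by convention, so no moment condition is
  -- needed.
  · exact integral_undef hi

/-! ### Orthogonality of the summands under the product law -/

section Product

variable {E : Type*} [MeasurableSpace E] (P : Measure E) [IsProbabilityMeasure P]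

lemma hasLaw_coord (i : ℕ) :
    HasLaw (fun x : ℕ → E => x i) P (Measure.infinitePi fun _ : ℕ => P) :=
  (measurePreserving_eval_infinitePi (fun _ : ℕ => P) i).hasLaw

lemma iIndepFun_coord :
    iIndepFun (fun (i : ℕ) (x : ℕ → E) => x i) (Measure.infinitePi fun _ : ℕ => P) :=
  iIndepFun_infinitePi (X := fun _ x => x) (fun _ => measurable_id)

lemma hasLaw_coord_pair {i j : ℕ} (hij : i ≠ j) :
    HasLaw (fun x : ℕ → E => (x i, x j)) (P.prod P) (Measure.infinitePi fun _ : ℕ => P) where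
  aemeasurable := by fun_prop
  map_eq := by
    have h := (iIndepFun_coord P).indepFun hij
    rw [(indepFun_iff_map_prod_eq_prod_map_map (hasLaw_coord P i).aemeasurable
      (hasLaw_coord P j).aemeasurable).1 h, (hasLaw_coord P i).map_eq, (hasLaw_coord P j).map_eq]

variable {P} {g : E → ℝ} {h : E → E → ℝ}

omit [IsProbabilityMeasure P] in
lemma measurable_pairTerm (hgh : DegeneratePair P g h) (p : ℕ × ℕ) :
    Measurable (pairTerm g h p) := by
  unfold pairTerm
  split_ifs
  · exact hgh.measurable_fst.comp (measurable_pi_apply _)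
  · exact hgh.measurable_snd.comp
      (g := Function.uncurry h) (f := fun x : ℕ → E => (x p.1, x p.2)) (by fun_prop)

lemma memLp_pairTerm (hgh : DegeneratePair P g h) (p : ℕ × ℕ) :
    MemLp (pairTerm g h p) 2 (Measure.infinitePi fun _ : ℕ => P) := by
  unfold pairTerm
  split_ifs with hp
  · exact MemLp.comp_measurePreserving hgh.memLp_fst
      (measurePreserving_eval_infinitePi (fun _ : ℕ => P) p.1)
  · exact MemLp.comp_measurePreserving hgh.memLp_snd
      ⟨by fun_prop, (hasLaw_coord_pair P hp).map_eq⟩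

lemma integral_pairTerm_sq (hgh : DegeneratePair P g h) (p : ℕ × ℕ) :
    ∫ x, pairTerm g h p x ^ 2 ∂(Measure.infinitePi fun _ : ℕ => P) =
      if p.1 = p.2 then ∫ x, g x ^ 2 ∂P else ∫ z, h z.1 z.2 ^ 2 ∂(P.prod P) := by
  unfold pairTerm
  split_ifs with hp
  · exact (hasLaw_coord P p.1).integral_comp (f := fun x => g x ^ 2)
      (hgh.measurable_fst.pow_const 2).aestronglyMeasurable
  · exact (hasLaw_coord_pair P hp).integral_comp (f := fun z => h z.1 z.2 ^ 2)
      (hgh.measurable_snd.pow_const 2).aestronglyMeasurable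

lemma integral_pairTerm (hgh : DegeneratePair P g h) (p : ℕ × ℕ) :
    ∫ x, pairTerm g h p x ∂(Measure.infinitePi fun _ : ℕ => P) = 0 := by
  unfold pairTerm
  split_ifs with hp
  · exact ((hasLaw_coord P p.1).integral_comp (f := g)
      hgh.measurable_fst.aestronglyMeasurable).trans hgh.integral_fst
  · refine ((hasLaw_coord_pair P hp).integral_comp (f := Function.uncurry h)
      hgh.measurable_snd.aestronglyMeasurable).trans ?_
    rw [integral_prod _ (hgh.memLp_snd.integrable (by norm_num))]
    exact integral_eq_zero_of_ae hgh.integral_snd_right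

/-- A term is orthogonal to every term that avoids one of its indices. -/
lemma integral_pairTerm_mul_of_notMem (hgh : DegeneratePair P g h) {p q : ℕ × ℕ} {a : ℕ}
    (hap : a = p.1 ∨ a = p.2) (haq : a ≠ q.1 ∧ a ≠ q.2) :
    ∫ x, pairTerm g h p x * pairTerm g h q x ∂(Measure.infinitePi fun _ : ℕ => P) = 0 := by
  obtain ⟨i, j⟩ := p
  obtain ⟨k, l⟩ := q
  simp only at hap haq
  -- Coordinate `a` is integrated out given the coordinates `b`, `k`, `l`. These may coincide, hence
  -- the vector indexed by the finset `S`.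
  have key : ∀ b : ℕ, a ≠ b → ∀ H : E → E → ℝ, Measurable (Function.uncurry H) →
      (∀ᵐ y ∂P, ∫ x, H x y ∂P = 0) →
      ∫ x, H (x a) (x b) * pairTerm g h (k, l) x ∂(Measure.infinitePi fun _ : ℕ => P) = 0 := by
    intro b hab H hH h0
    set S : Finset ℕ := {b, k, l} with hS
    have hbS : b ∈ S := by simp [hS]
    have hkS : k ∈ S := by simp [hS]
    have hlS : l ∈ S := by simp [hS]
    have haS : Disjoint ({a} : Finset ℕ) S := by
      simp [hS, hab, haq.1, haq.2]
    have hind := (iIndepFun_coord P).indepFun_finset {a} S haS (fun i => by fun_prop)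
    have hind' : IndepFun (fun x : ℕ → E => x a) (fun (x : ℕ → E) (s : S) => x s)
        (Measure.infinitePi fun _ : ℕ => P) :=
      hind.comp (φ := fun v : ({a} : Finset ℕ) → E => v ⟨a, Finset.mem_singleton_self a⟩)
        (ψ := id) (measurable_pi_apply _) measurable_id
    refine integral_mul_eq_zero_of_indepFun (hasLaw_coord P a) (V := fun (x : ℕ → E) (s : S) => x s)
      (by fun_prop) hind' (H := fun x v => H x (v ⟨b, hbS⟩)) ?_ ?_
      (G := fun v => if k = l then g (v ⟨k, hkS⟩) else h (v ⟨k, hkS⟩) (v ⟨l, hlS⟩)) ?_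
    · exact hH.comp (measurable_fst.prodMk ((measurable_pi_apply _).comp measurable_snd))
    · refine ae_of_ae_map (f := fun v : S → E => v ⟨b, hbS⟩)
        (p := fun y => ∫ x, H x y ∂P = 0)
        (measurable_pi_apply (⟨b, hbS⟩ : S)).aemeasurable ?_
      rw [Measure.map_map (by fun_prop) (by fun_prop)]
      simpa [Function.comp_def, (hasLaw_coord P b).map_eq] using h0
    · split_ifs
      · exact hgh.measurable_fst.comp (measurable_pi_apply _)
      · exact hgh.measurable_snd.comp (g := Function.uncurry h)
          (f := fun v : S → E => (v ⟨k, hkS⟩, v ⟨l, hlS⟩)) (by fun_prop)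
  by_cases hij : i = j
  · have hai : a = i := by omega
    -- On the diagonal the second argument is a dummy; `k` serves as some index different from `a`.
    have := key k haq.1 (fun x _ => g x) (hgh.measurable_fst.comp measurable_fst)
      (by simp [hgh.integral_fst])
    simpa [pairTerm, hij, hai] using this
  · rcases hap with rfl | rfl
    · have := key j hij h hgh.measurable_snd hgh.integral_snd_left
      simpa [pairTerm, hij] using this
    · have := key i (Ne.symm hij) (fun x y => h y x)
        (hgh.measurable_snd.comp measurable_swap) hgh.integral_snd_right
      simpa [pairTerm, hij] using this

/-- Ordered pairs are determined by their index sets, and two different sets cannot arise without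
one pair having an index that the other lacks: a proper inclusion means that one pair is diagonal.
Without the ordering, `(i, j)` and `(j, i)` would be a counterexample. -/
lemma integral_pairTerm_mul_of_ne (hgh : DegeneratePair P g h) {p q : ℕ × ℕ}
    (hp : p.1 ≤ p.2) (hq : q.1 ≤ q.2) (hpq : p ≠ q) :
    ∫ x, pairTerm g h p x * pairTerm g h q x ∂(Measure.infinitePi fun _ : ℕ => P) = 0 := by
  have hpq' : p.1 ≠ q.1 ∨ p.2 ≠ q.2 := by
    by_contra! hc
    exact hpq (Prod.ext hc.1 hc.2)
  have hcases : (∃ a, (a = p.1 ∨ a = p.2) ∧ a ≠ q.1 ∧ a ≠ q.2) ∨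
      ∃ a, (a = q.1 ∨ a = q.2) ∧ a ≠ p.1 ∧ a ≠ p.2 := by
    by_contra! hc
    have h1 := hc.1 p.1 (Or.inl rfl)
    have h2 := hc.1 p.2 (Or.inr rfl)
    have h3 := hc.2 q.1 (Or.inl rfl)
    have h4 := hc.2 q.2 (Or.inr rfl)
    omega
  rcases hcases with ⟨a, h1, h2⟩ | ⟨a, h1, h2⟩
  · exact integral_pairTerm_mul_of_notMem hgh h1 h2
  · simp_rw [mul_comm (pairTerm g h p _)]
    exact integral_pairTerm_mul_of_notMem hgh h1 h2

lemma integral_sum_pairTerm_sq (hgh : DegeneratePair P g h) (T : Finset (ℕ × ℕ))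
    (hT : ∀ p ∈ T, p.1 ≤ p.2) :
    ∫ x, (∑ p ∈ T, pairTerm g h p x) ^ 2 ∂(Measure.infinitePi fun _ : ℕ => P) =
      ∑ p ∈ T, if p.1 = p.2 then ∫ x, g x ^ 2 ∂P else ∫ z, h z.1 z.2 ^ 2 ∂(P.prod P) := by
  have hint : ∀ p q, Integrable (fun x => pairTerm g h p x * pairTerm g h q x)
      (Measure.infinitePi fun _ : ℕ => P) := fun p q =>
    (memLp_pairTerm hgh p).integrable_mul (memLp_pairTerm hgh q)
  simp_rw [sq, Finset.sum_mul_sum]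
  rw [integral_finsetSum _ fun p _ => integrable_finsetSum _ fun q _ => hint p q]
  refine Finset.sum_congr rfl fun p hp => ?_
  rw [integral_finsetSum _ fun q _ => hint p q, Finset.sum_eq_single_of_mem p hp]
  · simp_rw [← sq]
    exact integral_pairTerm_sq hgh p
  · exact fun q hq hqp => integral_pairTerm_mul_of_ne hgh (hT p hp) (hT q hq) hqp.symm

end Product

/-! ### Estimates for characteristic functions -/

lemma norm_pow_sub_pow_le {z w : ℂ} (hz : ‖z‖ ≤ 1) (hw : ‖w‖ ≤ 1) (n : ℕ) :
    ‖z ^ n - w ^ n‖ ≤ n * ‖z - w‖ := by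
  induction n with
  | zero => simp
  | succ n ih =>
    have h1 : z ^ (n + 1) - w ^ (n + 1) = z ^ n * (z - w) + (z ^ n - w ^ n) * w := by ring
    have h2 : ‖z‖ ^ n ≤ 1 := pow_le_one₀ (norm_nonneg _) hz
    rw [h1]
    refine (norm_add_le _ _).trans ?_
    rw [norm_mul, norm_mul, norm_pow]
    push_cast
    nlinarith [norm_nonneg (z - w), norm_nonneg (z ^ n - w ^ n), norm_nonneg w]

lemma tendsto_div_natCast_div (m : ℕ) :
    Tendsto (fun n : ℕ => ((n / m : ℕ) : ℝ) / n) atTop (𝓝 (m : ℝ)⁻¹) := by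
  have h := (tendsto_nat_floor_mul_div_atTop (R := ℝ) (a := (m : ℝ)⁻¹) (by positivity)).comp
    tendsto_natCast_atTop_atTop
  refine h.congr fun n => ?_
  simp only [Function.comp_apply]
  rw [← Nat.floor_div_eq_div (K := ℝ), div_eq_inv_mul (n : ℝ) (m : ℝ)]

/-- Powers of a function with a second order Taylor expansion at the origin, with an exponent
proportional to the index. -/
lemma tendsto_pow_div_of_isLittleO {φ : ℝ → ℂ} {v : ℝ} (hv : 0 ≤ v) (hφ : ∀ t, ‖φ t‖ ≤ 1)
    (h : (fun t : ℝ => φ t - (1 - v * t ^ 2 / 2)) =o[𝓝 0] fun t : ℝ => t ^ 2) (m : ℕ) :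
    Tendsto (fun n : ℕ => φ (√(n : ℝ))⁻¹ ^ (n / m)) atTop
      (𝓝 (Complex.exp ((-(v * (m : ℝ)⁻¹ / 2) : ℝ) : ℂ))) := by
  -- The Gaussian factor has the same second order expansion as `φ`, so the two differ by `o(t²)`
  -- and no complex logarithm is needed.
  have hexp : (fun t : ℝ => Complex.exp ((-(v * t ^ 2 / 2) : ℝ) : ℂ) - (1 - v * t ^ 2 / 2))
      =o[𝓝 0] fun t : ℝ => t ^ 2 := by
    have h1 : (fun z : ℂ => Complex.exp z - 1 - z) =o[𝓝 0] fun z : ℂ => z := by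
      have := (Complex.hasDerivAt_exp 0).isLittleO
      simpa using this
    have h2 : Tendsto (fun t : ℝ => ((-(v * t ^ 2 / 2) : ℝ) : ℂ)) (𝓝 0) (𝓝 0) := by
      have : Continuous (fun t : ℝ => ((-(v * t ^ 2 / 2) : ℝ) : ℂ)) := by fun_prop
      simpa using this.tendsto 0
    have h3 := h1.comp_tendsto h2
    have h4 : (fun t : ℝ => ((-(v * t ^ 2 / 2) : ℝ) : ℂ)) =O[𝓝 0] fun t : ℝ => t ^ 2 := by
      refine Asymptotics.isBigO_of_le' (c := v / 2) _ fun t => ?_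
      rw [Complex.norm_real, norm_neg, Real.norm_of_nonneg (by positivity),
        Real.norm_of_nonneg (by positivity)]
      linarith
    refine (h3.trans_isBigO h4).congr_left fun t => ?_
    simp only [Function.comp_apply]
    push_cast
    ring
  have hdiff : (fun t : ℝ => φ t - Complex.exp ((-(v * t ^ 2 / 2) : ℝ) : ℂ))
      =o[𝓝 0] fun t : ℝ => t ^ 2 := by
    refine (h.sub hexp).congr_left fun t => ?_
    ring
  have hs : Tendsto (fun n : ℕ => (√(n : ℝ))⁻¹) atTop (𝓝 0) :=
    tendsto_inv_atTop_zero.comp (Real.tendsto_sqrt_atTop.comp tendsto_natCast_atTop_atTop)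
  have hlim := (hdiff.norm_left.comp_tendsto hs).tendsto_div_nhds_zero
  have hw : Tendsto (fun n : ℕ =>
      Complex.exp ((-(v * (√(n : ℝ))⁻¹ ^ 2 / 2) : ℝ) : ℂ) ^ (n / m)) atTop
      (𝓝 (Complex.exp ((-(v * (m : ℝ)⁻¹ / 2) : ℝ) : ℂ))) := by
    have h1 : Tendsto (fun n : ℕ => ((-(v * (((n / m : ℕ) : ℝ) / n) / 2) : ℝ) : ℂ)) atTop
        (𝓝 ((-(v * (m : ℝ)⁻¹ / 2) : ℝ) : ℂ)) :=
      (Complex.continuous_ofReal.tendsto _).comp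
        ((((tendsto_div_natCast_div m).const_mul v).div_const 2).neg)
    refine ((Complex.continuous_exp.tendsto _).comp h1).congr fun n => ?_
    simp only [Function.comp_apply]
    rw [← Complex.exp_nat_mul, inv_pow, Real.sq_sqrt (by positivity)]
    congr 1
    push_cast
    ring
  refine tendsto_of_tendsto_of_dist hw ?_
  refine squeeze_zero (fun _ => dist_nonneg) (fun n => ?_) hlim
  have hw1 : ‖Complex.exp ((-(v * (√(n : ℝ))⁻¹ ^ 2 / 2) : ℝ) : ℂ)‖ ≤ 1 := by
    rw [Complex.norm_exp, Complex.ofReal_re, Real.exp_le_one_iff]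
    have : 0 ≤ v * (√(n : ℝ))⁻¹ ^ 2 / 2 := by positivity
    linarith
  -- At most `n` factors, each contributing an error `o(1 / n)`.
  rw [dist_comm, dist_eq_norm]
  refine (norm_pow_sub_pow_le (hφ _) hw1 _).trans ?_
  simp only [Function.comp_apply]
  rw [inv_pow, Real.sq_sqrt (Nat.cast_nonneg n), div_inv_eq_mul, mul_comm]
  gcongr
  exact Nat.div_le_self n m

/-- A second moment makes the characteristic function `C²`; centering removes the linear Taylor
term. -/
lemma isLittleO_charFun_map {Ω : Type*} [MeasurableSpace Ω] {μ : Measure Ω}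
    [IsProbabilityMeasure μ] {Y : Ω → ℝ} (hY : MemLp Y 2 μ) (h0 : ∫ ω, Y ω ∂μ = 0) :
    (fun t : ℝ => charFun (μ.map Y) t - (1 - (∫ ω, Y ω ^ 2 ∂μ : ℝ) * t ^ 2 / 2))
      =o[𝓝 0] fun t : ℝ => t ^ 2 := by
  have hm := hY.aestronglyMeasurable.aemeasurable
  have : IsProbabilityMeasure (μ.map Y) := Measure.isProbabilityMeasure_map hm
  have hid : MemLp id 2 (μ.map Y) := (memLp_map_measure_iff (by fun_prop) hm).2 hY
  have h := taylor_isLittleO_univ (x₀ := 0) (contDiff_charFun hid)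
  refine (h.congr_left fun t => ?_).congr_right fun t => by simp
  have h2 : ∫ ω, (Y ^ 2) ω ∂μ = ∫ ω, Y ω ^ 2 ∂μ := rfl
  rw [taylorWithinEval_charFun_two_zero hm hid, h0, h2]
  simp

lemma norm_exp_mul_I_sub_le (a b : ℝ) :
    ‖Complex.exp (a * Complex.I) - Complex.exp (b * Complex.I)‖ ≤ |a - b| := by
  have h1 : Complex.exp (a * Complex.I) - Complex.exp (b * Complex.I) =
      Complex.exp (b * Complex.I) * (Complex.exp (Complex.I * (a - b : ℝ)) - 1) := by
    rw [mul_sub, ← Complex.exp_add, mul_one]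
    congr 2
    push_cast
    ring
  rw [h1, norm_mul, Complex.norm_exp_ofReal_mul_I, one_mul]
  exact Real.norm_exp_I_mul_ofReal_sub_one_le

/-- Since `a ↦ exp (i a)` is 1-Lipschitz, perturbations small in `L¹` may be discarded, both for the
dropped windows and for the cyclic correction. -/
lemma norm_charFun_sub_le {Ω : Type*} [MeasurableSpace Ω] {μ : Measure Ω}
    [IsProbabilityMeasure μ] {Y Z : Ω → ℝ} (hY : AEMeasurable Y μ) (hZ : AEMeasurable Z μ)
    (hYZ : Integrable (fun ω => Y ω - Z ω) μ) :
    ‖(∫ ω, Complex.exp (Y ω * Complex.I) ∂μ) - ∫ ω, Complex.exp (Z ω * Complex.I) ∂μ‖ ≤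
      ∫ ω, |Y ω - Z ω| ∂μ := by
  have hint : ∀ W : Ω → ℝ, AEMeasurable W μ →
      Integrable (fun ω => Complex.exp (W ω * Complex.I)) μ := fun W hW => by
    refine Integrable.of_bound (C := 1) (by fun_prop) (ae_of_all _ fun ω => ?_)
    rw [Complex.norm_exp_ofReal_mul_I]
  rw [← integral_sub (hint Y hY) (hint Z hZ)]
  exact norm_integral_le_of_norm_le hYZ.abs
    (ae_of_all _ fun ω => norm_exp_mul_I_sub_le (Y ω) (Z ω))

lemma integral_abs_le_sqrt {Ω : Type*} [MeasurableSpace Ω] {μ : Measure Ω}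
    [IsProbabilityMeasure μ] {Y : Ω → ℝ} (hY : MemLp Y 2 μ) :
    ∫ ω, |Y ω| ∂μ ≤ √(∫ ω, Y ω ^ 2 ∂μ) := by
  refine Real.le_sqrt_of_sq_le ?_
  have h := variance_nonneg |Y| μ
  rw [variance_eq_sub hY.abs] at h
  simp only [Pi.pow_apply, Pi.abs_apply, sq_abs] at h
  linarith

/-! ### Windows, blocks and the central limit theorem -/

/-- The sum of the terms of all index pairs `(i, i), …, (i, i + d)`. -/
def windowSum {E : Type*} (g : E → ℝ) (h : E → E → ℝ) (d i : ℕ) (x : ℕ → E) : ℝ :=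
  ∑ k ∈ Finset.range (d + 1), pairTerm g h (i, i + k) x

/-- The sum of the `b` consecutive windows that fit into the `k`-th block of length `b + d`. -/
def blockSum {E : Type*} (g : E → ℝ) (h : E → E → ℝ) (d b k : ℕ) (x : ℕ → E) : ℝ :=
  ∑ l ∈ Finset.range b, windowSum g h d (k * (b + d) + l) x

/-- The variance of a window. -/
noncomputable def windowVar {E : Type*} [MeasurableSpace E] (P : Measure E) (g : E → ℝ)
    (h : E → E → ℝ) (d : ℕ) : ℝ :=
  ∫ x, g x ^ 2 ∂P + d * ∫ z, h z.1 z.2 ^ 2 ∂(P.prod P)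

lemma windowSum_eq {E : Type*} (g : E → ℝ) (h : E → E → ℝ) (d i : ℕ) (x : ℕ → E) :
    windowSum g h d i x = g (x i) + ∑ j ∈ Finset.Icc (i + 1) (i + d), h (x i) (x j) := by
  have h1 : Finset.Icc (i + 1) (i + d) = Finset.Ico (i + 1) (i + d + 1) := by
    ext j; simp only [Finset.mem_Icc, Finset.mem_Ico]; omega
  rw [windowSum, Finset.sum_range_succ', h1, Finset.sum_Ico_eq_sum_range, add_comm]
  congr 1
  · simp [pairTerm]
  · refine Finset.sum_congr (by congr 1; omega) fun k _ => ?_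
    rw [pairTerm, if_neg (by simp), add_assoc, add_comm 1 k]

section Blocks

variable {E : Type*} [MeasurableSpace E] {P : Measure E} [IsProbabilityMeasure P]
  {g : E → ℝ} {h : E → E → ℝ}

lemma windowVar_nonneg (P : Measure E) (g : E → ℝ) (h : E → E → ℝ) (d : ℕ) :
    0 ≤ windowVar P g h d :=
  add_nonneg (integral_nonneg fun _ => sq_nonneg _)
    (mul_nonneg (Nat.cast_nonneg d) (integral_nonneg fun _ => sq_nonneg _))

lemma memLp_windowSum (hgh : DegeneratePair P g h) (d i : ℕ) :
    MemLp (windowSum g h d i) 2 (Measure.infinitePi fun _ : ℕ => P) :=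
  memLp_finsetSum _ fun _ _ => memLp_pairTerm hgh _

lemma integral_windowSum (hgh : DegeneratePair P g h) (d i : ℕ) :
    ∫ x, windowSum g h d i x ∂(Measure.infinitePi fun _ : ℕ => P) = 0 := by
  unfold windowSum
  rw [integral_finsetSum _ fun k _ => (memLp_pairTerm hgh _).integrable (by norm_num)]
  exact Finset.sum_eq_zero fun k _ => integral_pairTerm hgh _

omit [IsProbabilityMeasure P] in
lemma measurable_windowSum (hgh : DegeneratePair P g h) (d i : ℕ) :
    Measurable (windowSum g h d i) :=
  Finset.measurable_sum _ fun _ _ => measurable_pairTerm hgh _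

omit [IsProbabilityMeasure P] in
lemma measurable_blockSum (hgh : DegeneratePair P g h) (d b k : ℕ) :
    Measurable (blockSum g h d b k) :=
  Finset.measurable_sum _ fun _ _ => measurable_windowSum hgh _ _

/-- Overlapping windows are dependent but share no index pair `(i, i + k)`, so all cross terms
vanish by orthogonality. -/
lemma integral_sum_windowSum_sq (hgh : DegeneratePair P g h) (d : ℕ) (I : Finset ℕ) :
    ∫ x, (∑ i ∈ I, windowSum g h d i x) ^ 2 ∂(Measure.infinitePi fun _ : ℕ => P) =
      I.card * windowVar P g h d := by
  have hinj : Set.InjOn (fun p : ℕ × ℕ => (p.1, p.1 + p.2))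
      (I ×ˢ Finset.range (d + 1) : Finset (ℕ × ℕ)) := by
    rintro ⟨a, b⟩ - ⟨a', b'⟩ - hab
    simp only [Prod.mk.injEq] at hab ⊢
    omega
  have h1 : ∀ F : ℕ × ℕ → ℝ, ∑ p ∈ (I ×ˢ Finset.range (d + 1)).image
      (fun p : ℕ × ℕ => (p.1, p.1 + p.2)), F p =
        ∑ i ∈ I, ∑ k ∈ Finset.range (d + 1), F (i, i + k) := fun F => by
    rw [Finset.sum_image hinj, Finset.sum_product]
  have h2 := integral_sum_pairTerm_sq hgh ((I ×ˢ Finset.range (d + 1)).image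
      (fun p : ℕ × ℕ => (p.1, p.1 + p.2))) (by
        simp only [Finset.mem_image, Prod.forall, Prod.mk.injEq, Prod.exists]
        omega)
  simp_rw [h1] at h2
  unfold windowSum
  rw [h2]
  simp [Finset.sum_range_succ', windowVar]
  ring

lemma memLp_blockSum (hgh : DegeneratePair P g h) (d b k : ℕ) :
    MemLp (blockSum g h d b k) 2 (Measure.infinitePi fun _ : ℕ => P) :=
  memLp_finsetSum _ fun _ _ => memLp_windowSum hgh _ _

lemma integral_blockSum (hgh : DegeneratePair P g h) (d b k : ℕ) :
    ∫ x, blockSum g h d b k x ∂(Measure.infinitePi fun _ : ℕ => P) = 0 := by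
  unfold blockSum
  rw [integral_finsetSum _ fun k _ => (memLp_windowSum hgh _ _).integrable (by norm_num)]
  exact Finset.sum_eq_zero fun k _ => integral_windowSum hgh _ _

lemma integral_blockSum_zero_sq (hgh : DegeneratePair P g h) (d b : ℕ) :
    ∫ x, blockSum g h d b 0 x ^ 2 ∂(Measure.infinitePi fun _ : ℕ => P) =
      b * windowVar P g h d := by
  simpa [blockSum] using integral_sum_windowSum_sq hgh d (Finset.range b)

variable (P) in
lemma measurePreserving_shift (a : ℕ) :
    MeasurePreserving (fun (x : ℕ → E) (i : ℕ) => x (a + i))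
      (Measure.infinitePi fun _ : ℕ => P) (Measure.infinitePi fun _ : ℕ => P) := by
  have hi := (iIndepFun_coord P).precomp (g := fun i => a + i) (add_right_injective a)
  have := hi.hasLaw_infinitePi (fun i => hasLaw_coord P (a + i))
    (measurable_pi_lambda _ fun i => measurable_pi_apply (a + i)).aemeasurable
  exact ⟨by fun_prop, this.map_eq⟩

/-- Block `k` is block `0` read along the shifted sequence, which has the same law. -/
lemma map_blockSum (hgh : DegeneratePair P g h) (d b k : ℕ) :
    (Measure.infinitePi fun _ : ℕ => P).map (blockSum g h d b k) =
      (Measure.infinitePi fun _ : ℕ => P).map (blockSum g h d b 0) := by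
  have h1 : blockSum g h d b k = blockSum g h d b 0 ∘ fun x i => x (k * (b + d) + i) := by
    ext x
    simp [blockSum, windowSum, pairTerm, add_assoc]
  conv_rhs => rw [← (measurePreserving_shift P (k * (b + d))).map_eq]
  rw [h1, Measure.map_map (measurable_blockSum hgh d b 0) (by fun_prop)]

omit [IsProbabilityMeasure P] in
lemma measurable_pairTerm_iSup (hgh : DegeneratePair P g h) {S : Set ℕ} {p : ℕ × ℕ}
    (h1 : p.1 ∈ S) (h2 : p.2 ∈ S) :
    Measurable[⨆ i ∈ S, MeasurableSpace.comap (fun x : ℕ → E => x i) inferInstance]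
      (pairTerm g h p) := by
  have hc : ∀ i ∈ S,
      Measurable[⨆ i ∈ S, MeasurableSpace.comap (fun x : ℕ → E => x i) inferInstance]
        (fun x : ℕ → E => x i) := fun i hi =>
    (comap_measurable (fun x : ℕ → E => x i)).mono
      (le_iSup₂ (f := fun i _ => MeasurableSpace.comap (fun x : ℕ → E => x i) inferInstance) i hi)
      le_rfl
  unfold pairTerm
  split_ifs
  · exact hgh.measurable_fst.comp (hc _ h1)
  · exact hgh.measurable_snd.comp (g := Function.uncurry h) ((hc _ h1).prodMk (hc _ h2))

/-- The last window kept in block `k` ends at index `k(b + d) + (b - 1) + d`, still inside the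
block. Hence the earlier blocks only see indices below `N(b + d)`, and block `N` only indices from
there on. -/
lemma indepFun_sum_blockSum (hgh : DegeneratePair P g h) (d b N : ℕ) :
    IndepFun (fun x => ∑ k ∈ Finset.range N, blockSum g h d b k x) (blockSum g h d b N)
      (Measure.infinitePi fun _ : ℕ => P) := by
  have hind := indep_iSup_of_disjoint (m := fun i : ℕ =>
      MeasurableSpace.comap (fun x : ℕ → E => x i) inferInstance)
    (μ := Measure.infinitePi fun _ : ℕ => P)
    (fun i => (measurable_pi_apply i).comap_le) (iIndepFun_coord P).iIndep
    (S := Set.Iio (N * (b + d))) (T := Set.Ici (N * (b + d)))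
    (Set.disjoint_left.2 fun _ ha hb => not_lt.2 (Set.mem_Ici.1 hb) ha)
  refine (IndepFun_iff_Indep _ _ _).2 (indep_of_indep_of_le_left
    (indep_of_indep_of_le_right hind ?_) ?_)
  · refine Measurable.comap_le ?_
    refine Finset.measurable_sum _ fun l hl => Finset.measurable_sum _ fun k hk => ?_
    refine measurable_pairTerm_iSup hgh ?_ ?_ <;> simp only [Set.mem_Ici] <;> omega
  · refine Measurable.comap_le ?_
    refine Finset.measurable_sum _ fun j hj => Finset.measurable_sum _ fun l hl =>
      Finset.measurable_sum _ fun k hk => ?_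
    rw [Finset.mem_range] at hj hl hk
    have h1 : (j + 1) * (b + d) ≤ N * (b + d) := Nat.mul_le_mul_right _ hj
    rw [add_mul, one_mul] at h1
    refine measurable_pairTerm_iSup hgh ?_ ?_ <;> simp only [Set.mem_Iio] <;> omega

lemma charFun_map_sum_blockSum (hgh : DegeneratePair P g h) (d b N : ℕ) (s : ℝ) :
    charFun ((Measure.infinitePi fun _ : ℕ => P).map
        fun x => ∑ k ∈ Finset.range N, blockSum g h d b k x) s =
      charFun ((Measure.infinitePi fun _ : ℕ => P).map (blockSum g h d b 0)) s ^ N := by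
  induction N with
  | zero => simp
  | succ N ih =>
    simp_rw [Finset.sum_range_succ]
    rw [(indepFun_sum_blockSum hgh d b N).charFun_map_fun_add_eq_mul
      (Finset.measurable_sum _ fun k _ => measurable_blockSum hgh d b k).aemeasurable
      (measurable_blockSum hgh d b N).aemeasurable, Pi.mul_apply, ih, map_blockSum hgh d b N,
      pow_succ]

/-- The windows outside the blocks are negligible. -/
lemma integral_sum_windowSum_sub_sum_blockSum_sq (hgh : DegeneratePair P g h) (d b n : ℕ) :
    ∫ x, (∑ i ∈ Finset.range n, windowSum g h d i x -
        ∑ k ∈ Finset.range (n / (b + d)), blockSum g h d b k x) ^ 2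
        ∂(Measure.infinitePi fun _ : ℕ => P) =
      (n - (n / (b + d) : ℕ) * b : ℝ) * windowVar P g h d := by
  set N := n / (b + d) with hN
  have hNn : N * (b + d) ≤ n := Nat.div_mul_le_self n (b + d)
  have hinj : Set.InjOn (fun p : ℕ × ℕ => p.1 * (b + d) + p.2)
      (Finset.range N ×ˢ Finset.range b : Finset (ℕ × ℕ)) := by
    rintro ⟨k, l⟩ hkl ⟨k', l'⟩ hkl' heq
    simp only [Finset.coe_product, Finset.coe_range, Set.mem_prod, Set.mem_Iio] at hkl hkl' heq
    have hl : l < b + d := by omega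
    have hl' : l' < b + d := by omega
    have h1 : (k * (b + d) + l) / (b + d) = k := by
      rw [mul_comm, Nat.mul_add_div (by omega), Nat.div_eq_of_lt hl, add_zero]
    have h2 : (k' * (b + d) + l') / (b + d) = k' := by
      rw [mul_comm, Nat.mul_add_div (by omega), Nat.div_eq_of_lt hl', add_zero]
    have hk : k = k' := by rw [← h1, ← h2, heq]
    subst hk
    simpa using heq
  -- `G` holds the starting indices of the kept windows. The difference is the sum of the windows
  -- over its complement, so the variance formula applies exactly.
  set G := (Finset.range N ×ˢ Finset.range b).image (fun p : ℕ × ℕ => p.1 * (b + d) + p.2)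
    with hG
  have hsub : G ⊆ Finset.range n := by
    intro i hi
    simp only [hG, Finset.mem_image, Finset.mem_product, Finset.mem_range, Prod.exists] at hi ⊢
    obtain ⟨k, l, ⟨hk, hl⟩, rfl⟩ := hi
    have h1 : (k + 1) * (b + d) ≤ N * (b + d) := Nat.mul_le_mul_right _ hk
    rw [add_mul, one_mul] at h1
    omega
  have hcard : G.card = N * b := by
    rw [hG, Finset.card_image_of_injOn hinj]; simp
  have hsum : ∀ x, ∑ i ∈ Finset.range n, windowSum g h d i x -
      ∑ k ∈ Finset.range N, blockSum g h d b k x =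
        ∑ i ∈ Finset.range n \ G, windowSum g h d i x := fun x => by
    rw [← Finset.sum_sdiff hsub, hG, Finset.sum_image hinj, Finset.sum_product]
    simp [blockSum]
  simp_rw [hsum]
  rw [integral_sum_windowSum_sq hgh, Finset.card_sdiff_of_subset hsub, hcard, Finset.card_range,
    Nat.cast_sub (hcard ▸ (Finset.card_le_card hsub).trans (Finset.card_range n).le)]
  push_cast
  ring

lemma norm_charFun_windowSum_sub_pow_le (hgh : DegeneratePair P g h) (d b n : ℕ) (hn : 0 < n)
    (hb : 0 < b) :
    ‖(∫ x, Complex.exp (((√(n : ℝ))⁻¹ * ∑ i ∈ Finset.range n, windowSum g h d i x : ℝ) *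
        Complex.I) ∂(Measure.infinitePi fun _ : ℕ => P)) -
      charFun ((Measure.infinitePi fun _ : ℕ => P).map (blockSum g h d b 0)) (√(n : ℝ))⁻¹ ^
        (n / (b + d))‖ ≤
      √((d / (b + d : ℝ) + b / n) * windowVar P g h d) := by
  have hmB : Measurable fun x : ℕ → E => ∑ k ∈ Finset.range (n / (b + d)), blockSum g h d b k x :=
    Finset.measurable_sum _ fun k _ => measurable_blockSum hgh d b k
  have hmW : Measurable fun x : ℕ → E => ∑ i ∈ Finset.range n, windowSum g h d i x :=
    Finset.measurable_sum _ fun k _ => measurable_windowSum hgh d k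
  have hmem : MemLp (fun x => (√(n : ℝ))⁻¹ * ∑ i ∈ Finset.range n, windowSum g h d i x -
      (√(n : ℝ))⁻¹ * ∑ k ∈ Finset.range (n / (b + d)), blockSum g h d b k x) 2
      (Measure.infinitePi fun _ : ℕ => P) :=
    ((memLp_finsetSum _ fun i _ => memLp_windowSum hgh d i).const_mul _).sub
      ((memLp_finsetSum _ fun i _ => memLp_blockSum hgh d b i).const_mul _)
  rw [← charFun_map_sum_blockSum hgh, charFun_apply_real,
    integral_map hmB.aemeasurable (by fun_prop)]
  simp_rw [← Complex.ofReal_mul]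
  refine (norm_charFun_sub_le (hmW.const_mul _).aemeasurable (hmB.const_mul _).aemeasurable
    (hmem.integrable (by norm_num))).trans ((integral_abs_le_sqrt hmem).trans ?_)
  refine Real.sqrt_le_sqrt ?_
  simp_rw [← mul_sub, mul_pow]
  rw [integral_const_mul, integral_sum_windowSum_sub_sum_blockSum_sq hgh, inv_pow,
    Real.sq_sqrt (Nat.cast_nonneg n), ← mul_assoc]
  refine mul_le_mul_of_nonneg_right ?_ (windowVar_nonneg P g h d)
  have hn' : (0 : ℝ) < n := by exact_mod_cast hn
  have hb' : (0 : ℝ) < b := by exact_mod_cast hb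
  have hlt : (n : ℝ) < ((n / (b + d) : ℕ) + 1) * (b + d) := by
    have := Nat.lt_div_mul_add (a := n) (b := b + d) (by omega)
    have h2 : (n : ℝ) < (n / (b + d) : ℕ) * (b + d : ℕ) + (b + d : ℕ) := by exact_mod_cast this
    push_cast at h2 ⊢
    linarith
  -- The number of complete blocks is at least `n / (b + d) - 1`: the gaps yield the term `d / (b +
  -- d)` of the bound, the incomplete last block yields `b / n`.
  have hdiv : (n : ℝ) / (b + d) - 1 ≤ (n / (b + d) : ℕ) := by
    rw [sub_le_iff_le_add, div_le_iff₀ (by positivity)]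
    exact hlt.le
  rw [inv_mul_le_iff₀ hn']
  have h3 : (n : ℝ) * (d / (b + d) + b / n) = n - (n / (b + d) - 1) * b := by
    field_simp
    ring
  rw [h3]
  gcongr

/-- Central limit theorem for the windows, in terms of characteristic functions. -/
theorem tendsto_charFun_windowSum (hgh : DegeneratePair P g h) (d : ℕ) :
    Tendsto (fun n : ℕ => ∫ x, Complex.exp
        (((√(n : ℝ))⁻¹ * ∑ i ∈ Finset.range n, windowSum g h d i x : ℝ) * Complex.I)
        ∂(Measure.infinitePi fun _ : ℕ => P)) atTop
      (𝓝 (Complex.exp ((-(windowVar P g h d / 2) : ℝ) : ℂ))) := by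
  set v := windowVar P g h d with hv
  have hv0 : 0 ≤ v := windowVar_nonneg P g h d
  have hb1 : Tendsto (fun b : ℕ => (d : ℝ) / (b + d)) atTop (𝓝 0) :=
    tendsto_const_nhds.div_atTop
      (tendsto_atTop_add_const_right _ _ tendsto_natCast_atTop_atTop)
  -- The `+ 0` stands for the limit of `b / n` as `n → ∞` with `b` fixed.
  have hb2 : Tendsto (fun b : ℕ => √(((d : ℝ) / (b + d) + 0) * v)) atTop (𝓝 0) := by
    have := ((hb1.add_const 0).mul_const v).sqrt
    simpa using this
  have hb3 : Tendsto (fun b : ℕ => Complex.exp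
      ((-((b * v) * ((b + d : ℕ) : ℝ)⁻¹ / 2) : ℝ) : ℂ)) atTop
      (𝓝 (Complex.exp ((-(v / 2) : ℝ) : ℂ))) := by
    have h1 : Tendsto (fun b : ℕ => ((-((b * v) * ((b + d : ℕ) : ℝ)⁻¹ / 2) : ℝ) : ℂ)) atTop
        (𝓝 ((-(v / 2) : ℝ) : ℂ)) := by
      refine (Complex.continuous_ofReal.tendsto _).comp ?_
      have h2 : Tendsto (fun b : ℕ => -((1 - (d : ℝ) / (b + d)) * v / 2)) atTop
          (𝓝 (-((1 - 0) * v / 2))) := (((hb1.const_sub 1).mul_const v).div_const 2).neg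
      rw [sub_zero, one_mul] at h2
      refine h2.congr' ?_
      filter_upwards [eventually_gt_atTop 0] with b hb
      have hb' : (0 : ℝ) < b := by exact_mod_cast hb
      push_cast
      field_simp
      ring
    exact (Complex.continuous_exp.tendsto _).comp h1
  rw [Metric.tendsto_atTop]
  intro ε hε
  -- The block length is fixed before `n` grows: one `ε / 3` for the dropped windows, one for
  -- replacing `v` by `b v / (b + d)`, and below one for the i.i.d. limit.
  obtain ⟨b, hb0, hbe, hbd⟩ : ∃ b : ℕ, 0 < b ∧ √(((d : ℝ) / (b + d) + 0) * v) < ε / 3 ∧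
      dist (Complex.exp ((-((b * v) * ((b + d : ℕ) : ℝ)⁻¹ / 2) : ℝ) : ℂ))
        (Complex.exp ((-(v / 2) : ℝ) : ℂ)) < ε / 3 :=
    ((eventually_gt_atTop 0).and ((hb2.eventually_lt_const (by positivity)).and
      (hb3.eventually (Metric.ball_mem_nhds _ (by positivity))))).exists
  have hm := measurable_blockSum hgh d b 0
  have : IsProbabilityMeasure ((Measure.infinitePi fun _ : ℕ => P).map (blockSum g h d b 0)) :=
    Measure.isProbabilityMeasure_map hm.aemeasurable
  have hlim := tendsto_pow_div_of_isLittleO (mul_nonneg (Nat.cast_nonneg b) hv0)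
    (fun t => norm_charFun_le_one (μ := (Measure.infinitePi fun _ : ℕ => P).map
      (blockSum g h d b 0)) t)
    (by
      have := isLittleO_charFun_map (memLp_blockSum hgh d b 0) (integral_blockSum hgh d b 0)
      rwa [integral_blockSum_zero_sq hgh] at this) (b + d)
  have hn2 : Tendsto (fun n : ℕ => √(((d : ℝ) / (b + d) + b / n) * v)) atTop
      (𝓝 √(((d : ℝ) / (b + d) + 0) * v)) :=
    (((tendsto_const_div_atTop_nhds_zero_nat (b : ℝ)).const_add _).mul_const v).sqrt
  obtain ⟨M, hM⟩ := eventually_atTop.1 ((eventually_gt_atTop 0).and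
    ((hn2.eventually_lt_const hbe).and
      (hlim.eventually (Metric.ball_mem_nhds _ (show 0 < ε / 3 by positivity)))))
  refine ⟨M, fun n hn => ?_⟩
  obtain ⟨hn0, hne, hnd⟩ := hM n hn
  have h1 := (norm_charFun_windowSum_sub_pow_le hgh d b n hn0 hb0).trans_lt hne
  rw [← dist_eq_norm] at h1
  have h2 := dist_triangle4 (∫ x, Complex.exp
    (((√(n : ℝ))⁻¹ * ∑ i ∈ Finset.range n, windowSum g h d i x : ℝ) * Complex.I)
        ∂(Measure.infinitePi fun _ : ℕ => P)) _ _ (Complex.exp ((-(v / 2) : ℝ) : ℂ))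
        |>.trans_lt (add_lt_add (add_lt_add h1 hnd) hbd)
  linarith

end Blocks

/-! ### Covariance matrices as quadratic forms -/

section Covariance

variable {r : ℕ} {S : Type*} [MeasurableSpace S] {μ : Measure S} [IsProbabilityMeasure μ]
  {Y : S → EuclideanSpace ℝ (Fin r)}

lemma dotProduct_covMatrix_mulVec (hY : MemLp Y 2 μ) (t : EuclideanSpace ℝ (Fin r)) :
    t.ofLp ⬝ᵥ covMatrix Y μ *ᵥ t.ofLp = Var[fun s => ⟪Y s, t⟫; μ] := by
  have hcoord : ∀ a, MemLp (fun s => Y s a) 2 μ := fun a => hY.eval_piLp a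
  have hm : MemLp (fun s => ⟪Y s, t⟫) 2 μ := hY.inner_const t
  have hin : (fun s => ⟪Y s, t⟫) = fun s => ∑ a, t a * Y s a := by
    ext s
    simp [PiLp.inner_apply]
  rw [← covariance_self hm.aestronglyMeasurable.aemeasurable, hin,
    covariance_fun_sum_fun_sum (fun a => (hcoord a).const_mul _) (fun a => (hcoord a).const_mul _)]
  simp only [covariance_const_mul_left, covariance_const_mul_right, dotProduct, Matrix.mulVec,
    covMatrix, Matrix.of_apply, Finset.mul_sum]
  refine Finset.sum_congr rfl fun a _ => Finset.sum_congr rfl fun b _ => ?_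
  ring

lemma posSemidef_covMatrix (hY : MemLp Y 2 μ) : (covMatrix Y μ).PosSemidef := by
  refine Matrix.PosSemidef.of_dotProduct_mulVec_nonneg ?_ fun v => ?_
  · ext a b
    simp [covMatrix, covariance_comm]
  · have := dotProduct_covMatrix_mulVec hY (WithLp.toLp 2 v)
    simp only [star_trivial]
    exact (variance_nonneg _ _).trans_eq this.symm

lemma dotProduct_covMatrix_mulVec_of_centered (hY : MemLp Y 2 μ) (h0 : ∫ s, Y s ∂μ = 0)
    (t : EuclideanSpace ℝ (Fin r)) :
    t.ofLp ⬝ᵥ covMatrix Y μ *ᵥ t.ofLp = ∫ s, ⟪Y s, t⟫ ^ 2 ∂μ := by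
  have hm : MemLp (fun s => ⟪Y s, t⟫) 2 μ := hY.inner_const t
  have h1 : ∫ s, ⟪Y s, t⟫ ∂μ = 0 := by
    simp_rw [real_inner_comm t]
    rw [integral_inner (hY.integrable (by norm_num)), h0, inner_zero_right]
  rw [dotProduct_covMatrix_mulVec hY, variance_of_integral_eq_zero
    hm.aestronglyMeasurable.aemeasurable h1]

end Covariance

/-- Averaging over one variable contracts `L²`, by Jensen's inequality on almost every section. -/
lemma memLp_integral_prod_right {S T F : Type*} [MeasurableSpace S] [MeasurableSpace T]
    [NormedAddCommGroup F] [NormedSpace ℝ F] {μ : Measure S} {ν : Measure T} [SFinite μ]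
    [IsProbabilityMeasure ν] [IsFiniteMeasure μ] {K : S × T → F} (hK : MemLp K 2 (μ.prod ν)) :
    MemLp (fun x => ∫ y, K (x, y) ∂ν) 2 μ := by
  have hm : AEStronglyMeasurable (fun x => ∫ y, K (x, y) ∂ν) μ :=
    hK.aestronglyMeasurable.integral_prod_right'
  have hsq : Integrable (fun p => ‖K p‖ ^ 2) (μ.prod ν) := hK.integrable_norm_pow (by norm_num)
  refine (memLp_two_iff_integrable_sq_norm hm).2 ?_
  refine hsq.integral_prod_left.mono' (hm.norm.pow 2) ?_
  filter_upwards [hsq.prod_right_ae, hK.aestronglyMeasurable.prodMk_left] with x hx hxm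
  rw [Real.norm_of_nonneg (by positivity)]
  have h2 : MemLp (fun y => ‖K (x, y)‖) 2 ν :=
    ((memLp_two_iff_integrable_sq_norm hxm).2 hx).norm
  have h3 := integral_abs_le_sqrt h2
  simp only [abs_norm] at h3
  calc ‖∫ y, K (x, y) ∂ν‖ ^ 2 ≤ (√(∫ y, ‖K (x, y)‖ ^ 2 ∂ν)) ^ 2 := by
        gcongr
        exact (norm_integral_le_integral_norm _).trans h3
    _ = ∫ y, ‖K (x, y)‖ ^ 2 ∂ν := Real.sq_sqrt (integral_nonneg fun _ => by positivity)

/-! ### Integrability and degeneracy of the Hoeffding terms -/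

section Hoeffding

variable {q r : ℕ} {P : Measure (EuclideanSpace ℝ (Fin q))} [IsProbabilityMeasure P]
  {f : EuclideanSpace ℝ (Fin q) → EuclideanSpace ℝ (Fin r)}

lemma symmKernel_sub_comm (f : EuclideanSpace ℝ (Fin q) → EuclideanSpace ℝ (Fin r))
    (x y : EuclideanSpace ℝ (Fin q)) : symmKernel f (x - y) = symmKernel f (y - x) := by
  simp [symmKernel, add_comm]

lemma hoeffding₂_comm (P : Measure (EuclideanSpace ℝ (Fin q)))
    (f : EuclideanSpace ℝ (Fin q) → EuclideanSpace ℝ (Fin r)) (x y : EuclideanSpace ℝ (Fin q)) :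
    hoeffding₂ P f x y = hoeffding₂ P f y x := by
  simp only [hoeffding₂, symmKernel_sub_comm f x y]
  abel

lemma measurable_symmKernel (hf : Measurable f) : Measurable (symmKernel f) := by
  unfold symmKernel
  fun_prop

lemma measurable_hoeffding₁ (hf : Measurable f) : Measurable (hoeffding₁ P f) := by
  have h1 : StronglyMeasurable
      (fun p : EuclideanSpace ℝ (Fin q) × EuclideanSpace ℝ (Fin q) => symmKernel f (p.1 - p.2)) :=
    ((measurable_symmKernel hf).comp (by fun_prop)).stronglyMeasurable
  exact h1.integral_prod_right'.measurable.sub_const _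

lemma measurable_hoeffding₂ (hf : Measurable f) :
    Measurable (Function.uncurry (hoeffding₂ P f)) := by
  have h1 := measurable_symmKernel hf
  have h2 := measurable_hoeffding₁ (P := P) hf
  unfold hoeffding₂ Function.uncurry
  fun_prop

omit [IsProbabilityMeasure P] in
lemma memLp_kernel (hf : Measurable f)
    (hf2 : Integrable (fun p : EuclideanSpace ℝ (Fin q) × EuclideanSpace ℝ (Fin q) =>
      ‖f (p.1 - p.2)‖ ^ 2) (P.prod P)) :
    MemLp (fun p : EuclideanSpace ℝ (Fin q) × EuclideanSpace ℝ (Fin q) => f (p.1 - p.2)) 2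
      (P.prod P) :=
  (memLp_two_iff_integrable_sq_norm (Measurable.aestronglyMeasurable (by fun_prop))).2 hf2

variable (hf : Measurable f)
  (hf2 : Integrable (fun p : EuclideanSpace ℝ (Fin q) × EuclideanSpace ℝ (Fin q) =>
      ‖f (p.1 - p.2)‖ ^ 2) (P.prod P))
include hf hf2

lemma memLp_symmKernel :
    MemLp (fun p : EuclideanSpace ℝ (Fin q) × EuclideanSpace ℝ (Fin q) =>
      symmKernel f (p.1 - p.2)) 2 (P.prod P) := by
  have h1 := memLp_kernel hf hf2
  have h2 := h1.comp_measurePreserving (Measure.measurePreserving_swap (μ := P) (ν := P))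
  refine ((h1.add h2).const_smul (2 : ℝ)⁻¹).congr_norm
    ((measurable_symmKernel hf).comp (by fun_prop)).aestronglyMeasurable (ae_of_all _ fun p => ?_)
  simp [symmKernel]

lemma integral_symmKernel :
    ∫ p, symmKernel f (p.1 - p.2) ∂(P.prod P) = kernelMean P f := by
  have h1 := memLp_kernel hf hf2
  have h2 := h1.comp_measurePreserving (Measure.measurePreserving_swap (μ := P) (ν := P))
  have h3 : ∫ p, f (p.2 - p.1) ∂(P.prod P) = ∫ p, f (p.1 - p.2) ∂(P.prod P) :=
    integral_prod_swap (fun p : EuclideanSpace ℝ (Fin q) × EuclideanSpace ℝ (Fin q) =>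
      f (p.1 - p.2))
  have h4 := integral_add (h1.integrable (by norm_num)) (h2.integrable (by norm_num))
  simp only [Function.comp_apply, Prod.fst_swap, Prod.snd_swap] at h4
  simp only [symmKernel, neg_sub, kernelMean]
  rw [integral_smul, h4, h3, ← two_smul ℝ, smul_smul]
  norm_num

lemma memLp_hoeffding₁ : MemLp (hoeffding₁ P f) 2 P :=
  (memLp_integral_prod_right (memLp_symmKernel hf hf2)).sub (memLp_const _)

lemma integral_hoeffding₁ : ∫ x, hoeffding₁ P f x ∂P = 0 := by
  have h1 := (memLp_symmKernel hf hf2).integrable (by norm_num : (1 : ENNReal) ≤ 2)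
  unfold hoeffding₁
  rw [integral_sub h1.integral_prod_left (integrable_const _), ← integral_prod _ h1,
    integral_symmKernel hf hf2]
  simp

lemma memLp_hoeffding₂ :
    MemLp (fun p : EuclideanSpace ℝ (Fin q) × EuclideanSpace ℝ (Fin q) =>
      hoeffding₂ P f p.1 p.2) 2 (P.prod P) := by
  have h1 := memLp_hoeffding₁ hf hf2
  exact (((memLp_symmKernel hf hf2).sub (memLp_const _)).sub
    (h1.comp_measurePreserving measurePreserving_fst)).sub
    (h1.comp_measurePreserving measurePreserving_snd)

lemma integral_hoeffding₂_right :
    ∀ᵐ x ∂P, ∫ y, hoeffding₂ P f x y ∂P = 0 := by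
  have h1 := (memLp_symmKernel hf hf2).integrable (by norm_num : (1 : ENNReal) ≤ 2)
  have h2 := (memLp_hoeffding₁ hf hf2).integrable (by norm_num : (1 : ENNReal) ≤ 2)
  -- This removes the null set of `x` with non-integrable section, where the value of `hoeffding₁`
  -- is only a convention.
  filter_upwards [h1.prod_right_ae] with x hx
  have h3 : ∀ y, hoeffding₂ P f x y =
      symmKernel f (x - y) - (kernelMean P f + hoeffding₁ P f x) - hoeffding₁ P f y := fun y => by
    simp only [hoeffding₂]; abel
  simp_rw [h3]
  rw [integral_sub (f := fun y => symmKernel f (x - y) - (kernelMean P f + hoeffding₁ P f x))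
    (hx.sub (integrable_const _)) h2, integral_sub hx (integrable_const _),
    integral_hoeffding₁ hf hf2]
  simp [hoeffding₁]

lemma integral_hoeffding₂ : ∫ p, hoeffding₂ P f p.1 p.2 ∂(P.prod P) = 0 := by
  rw [integral_prod (fun p => hoeffding₂ P f p.1 p.2)
    ((memLp_hoeffding₂ hf hf2).integrable (by norm_num))]
  exact integral_eq_zero_of_ae (integral_hoeffding₂_right hf hf2)

lemma degeneratePair_inner (t u : EuclideanSpace ℝ (Fin r)) (c : ℝ) :
    DegeneratePair P (fun x => ⟪hoeffding₁ P f x, t⟫)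
      (fun x y => c * ⟪hoeffding₂ P f x y, u⟫) where
  measurable_fst := (measurable_hoeffding₁ hf).inner_const
  measurable_snd := (measurable_hoeffding₂ hf).inner_const.const_mul c
  memLp_fst := (memLp_hoeffding₁ hf hf2).inner_const t
  memLp_snd := ((memLp_hoeffding₂ hf hf2).inner_const u).const_mul c
  integral_fst := by
    simp_rw [real_inner_comm t]
    rw [integral_inner ((memLp_hoeffding₁ hf hf2).integrable (by norm_num)),
      integral_hoeffding₁ hf hf2, inner_zero_right]
  integral_snd_right := by
    filter_upwards [integral_hoeffding₂_right hf hf2,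
      ((memLp_hoeffding₂ hf hf2).integrable (by norm_num : (1 : ENNReal) ≤ 2)).prod_right_ae]
      with x hx hxi
    simp_rw [real_inner_comm u]
    rw [integral_const_mul, integral_inner hxi, hx, inner_zero_right, mul_zero]
  integral_snd_left := by
    filter_upwards [integral_hoeffding₂_right hf hf2,
      ((memLp_hoeffding₂ hf hf2).integrable (by norm_num : (1 : ENNReal) ≤ 2)).prod_right_ae]
      with x hx hxi
    simp_rw [real_inner_comm u, hoeffding₂_comm P f _ x]
    rw [integral_const_mul, integral_inner hxi, hx, inner_zero_right, mul_zero]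

/-- The squared factor `d^(-1/2)` cancels the number `d` of off-diagonal terms in a window. -/
lemma windowVar_inner (t u : EuclideanSpace ℝ (Fin r)) {d : ℕ} (hd : 1 ≤ d) :
    windowVar P (fun x => ⟪hoeffding₁ P f x, t⟫)
        (fun x y => (√(d : ℝ))⁻¹ * ⟪hoeffding₂ P f x y, u⟫) d =
      t.ofLp ⬝ᵥ Γ₁ P f *ᵥ t.ofLp + u.ofLp ⬝ᵥ Γ₂ P f *ᵥ u.ofLp := by
  have hd' : (d : ℝ) ≠ 0 := by positivity
  unfold windowVar Γ₁ Γ₂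
  rw [dotProduct_covMatrix_mulVec_of_centered (memLp_hoeffding₁ hf hf2)
    (integral_hoeffding₁ hf hf2), dotProduct_covMatrix_mulVec_of_centered
    (memLp_hoeffding₂ hf hf2) (integral_hoeffding₂ hf hf2)]
  simp_rw [mul_pow]
  rw [integral_const_mul, inv_pow, Real.sq_sqrt (Nat.cast_nonneg d), mul_inv_cancel_left₀ hd']

end Hoeffding

/-! ### Cyclic indices -/

/-- The sum of the first `n` windows, with second indices read modulo `n`. -/
def cyclicSum {E : Type*} (g : E → ℝ) (h : E → E → ℝ) (d n : ℕ) (x : ℕ → E) : ℝ :=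
  ∑ i ∈ Finset.range n, (g (x i) + ∑ j ∈ Finset.Icc (i + 1) (i + d), h (x i) (x (j % n)))

section Cyclic

variable {E : Type*} [MeasurableSpace E] {P : Measure E} [IsProbabilityMeasure P]
  {g : E → ℝ} {h : E → E → ℝ}

omit [IsProbabilityMeasure P] in
lemma measurable_cyclicSum (hgh : DegeneratePair P g h) (d n : ℕ) :
    Measurable (cyclicSum g h d n) := by
  have h1 := hgh.measurable_fst
  have h2 : ∀ i j : ℕ, Measurable fun x : ℕ → E => h (x i) (x j) := fun i j =>
    hgh.measurable_snd.comp (g := Function.uncurry h) (f := fun x : ℕ → E => (x i, x j))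
      (by fun_prop)
  exact Finset.measurable_sum _ fun i _ => (h1.comp (measurable_pi_apply i)).add
    (Finset.measurable_sum _ fun j _ => h2 _ _)

omit [MeasurableSpace E] in
-- Only windows starting among the last `d` indices reach beyond `n - 1`.
lemma cyclicSum_sub_sum_windowSum (g : E → ℝ) (h : E → E → ℝ) (d n : ℕ) (x : ℕ → E) :
    cyclicSum g h d n x - ∑ i ∈ Finset.range n, windowSum g h d i x =
      ∑ i ∈ Finset.Ico (n - d) n, ∑ j ∈ Finset.Icc (i + 1) (i + d),
        (h (x i) (x (j % n)) - h (x i) (x j)) := by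
  simp_rw [windowSum_eq, cyclicSum]
  rw [← Finset.sum_sub_distrib]
  simp_rw [add_sub_add_left_eq_sub, ← Finset.sum_sub_distrib]
  symm
  refine Finset.sum_subset (fun i hi => ?_) fun i hi hi' => Finset.sum_eq_zero fun j hj => ?_
  · simp only [Finset.mem_Ico, Finset.mem_range] at hi ⊢
    omega
  · simp only [Finset.mem_Ico, Finset.mem_range, Finset.mem_Icc] at hi hi' hj
    rw [Nat.mod_eq_of_lt (by omega), sub_self]

lemma integrable_kernel_coord (hgh : DegeneratePair P g h) {i j : ℕ} (hij : i ≠ j) :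
    Integrable (fun x : ℕ → E => h (x i) (x j)) (Measure.infinitePi fun _ : ℕ => P) := by
  have := (memLp_pairTerm hgh (i, j)).integrable (by norm_num)
  exact this.congr (ae_of_all _ fun x => by simp [pairTerm, hij])

lemma integral_abs_kernel_coord (hgh : DegeneratePair P g h) {i j : ℕ} (hij : i ≠ j) :
    ∫ x : ℕ → E, |h (x i) (x j)| ∂(Measure.infinitePi fun _ : ℕ => P) =
      ∫ z, |h z.1 z.2| ∂(P.prod P) :=
  (hasLaw_coord_pair P hij).integral_comp (f := fun z => |h z.1 z.2|)
    hgh.measurable_snd.abs.aestronglyMeasurable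

/-- Reading indices cyclically changes the sum by a term that stays bounded in `L¹`. -/
lemma integral_abs_cyclicSum_sub_le (hgh : DegeneratePair P g h) {d n : ℕ} (hn : d < n) :
    Integrable (fun x => cyclicSum g h d n x - ∑ i ∈ Finset.range n, windowSum g h d i x)
        (Measure.infinitePi fun _ : ℕ => P) ∧
      ∫ x, |cyclicSum g h d n x - ∑ i ∈ Finset.range n, windowSum g h d i x|
        ∂(Measure.infinitePi fun _ : ℕ => P) ≤
      d * (d * (2 * ∫ z, |h z.1 z.2| ∂(P.prod P))) := by
  -- As `d < n`, a wrapped index never returns to `i`, so every kernel value has the law of `h`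
  -- under `P.prod P`. Pairs may repeat here: an `L¹` bound needs no orthogonality.
  have hne : ∀ i ∈ Finset.Ico (n - d) n, ∀ j ∈ Finset.Icc (i + 1) (i + d),
      i ≠ j ∧ i ≠ j % n := by
    intro i hi j hj
    simp only [Finset.mem_Ico, Finset.mem_Icc] at hi hj
    refine ⟨by omega, ?_⟩
    by_cases hjn : j < n
    · rw [Nat.mod_eq_of_lt hjn]; omega
    · rw [Nat.mod_eq_sub_mod (by omega), Nat.mod_eq_of_lt (by omega)]; omega
  have hint : ∀ i ∈ Finset.Ico (n - d) n, ∀ j ∈ Finset.Icc (i + 1) (i + d),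
      Integrable (fun x : ℕ → E => h (x i) (x (j % n)) - h (x i) (x j))
        (Measure.infinitePi fun _ : ℕ => P) := fun i hi j hj =>
    (integrable_kernel_coord hgh (hne i hi j hj).2).sub
      (integrable_kernel_coord hgh (hne i hi j hj).1)
  simp_rw [cyclicSum_sub_sum_windowSum]
  refine ⟨integrable_finsetSum _ fun i hi => integrable_finsetSum _ fun j hj => hint i hi j hj, ?_⟩
  have habs : ∀ i ∈ Finset.Ico (n - d) n, Integrable (fun x : ℕ → E =>
      ∑ j ∈ Finset.Icc (i + 1) (i + d), |h (x i) (x (j % n)) - h (x i) (x j)|)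
        (Measure.infinitePi fun _ : ℕ => P) := fun i hi =>
    integrable_finsetSum _ fun j hj => (hint i hi j hj).abs
  calc _ ≤ ∫ x : ℕ → E, ∑ i ∈ Finset.Ico (n - d) n, ∑ j ∈ Finset.Icc (i + 1) (i + d),
        |h (x i) (x (j % n)) - h (x i) (x j)| ∂(Measure.infinitePi fun _ : ℕ => P) := by
        refine integral_mono_of_nonneg (ae_of_all _ fun _ => abs_nonneg _)
          (integrable_finsetSum _ habs) (ae_of_all _ fun x => ?_)
        exact (Finset.abs_sum_le_sum_abs _ _).trans
          (Finset.sum_le_sum fun i _ => Finset.abs_sum_le_sum_abs _ _)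
    _ = ∑ i ∈ Finset.Ico (n - d) n, ∑ j ∈ Finset.Icc (i + 1) (i + d),
        ∫ x : ℕ → E, |h (x i) (x (j % n)) - h (x i) (x j)|
          ∂(Measure.infinitePi fun _ : ℕ => P) := by
        rw [integral_finsetSum _ habs]
        exact Finset.sum_congr rfl fun i hi =>
          integral_finsetSum _ fun j hj => (hint i hi j hj).abs
    _ ≤ ∑ i ∈ Finset.Ico (n - d) n, ∑ j ∈ Finset.Icc (i + 1) (i + d),
        2 * ∫ z, |h z.1 z.2| ∂(P.prod P) := by
        refine Finset.sum_le_sum fun i hi => Finset.sum_le_sum fun j hj => ?_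
        have h1 := integrable_kernel_coord hgh (hne i hi j hj).1
        have h2 := integrable_kernel_coord hgh (hne i hi j hj).2
        rw [two_mul]
        nth_rewrite 1 [← integral_abs_kernel_coord hgh (hne i hi j hj).2]
        rw [← integral_abs_kernel_coord hgh (hne i hi j hj).1, ← integral_add h2.abs h1.abs]
        exact integral_mono (hint i hi j hj).abs (h2.abs.add h1.abs) fun x => abs_sub _ _
    _ = _ := by
        have hc : ∀ i, (Finset.Icc (i + 1) (i + d)).card = d := fun i => by simp
        simp only [Finset.sum_const, hc, Nat.card_Ico, nsmul_eq_mul, Nat.sub_sub_self hn.le]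

theorem tendsto_charFun_cyclicSum (hgh : DegeneratePair P g h) (d : ℕ) :
    Tendsto (fun n : ℕ => ∫ x, Complex.exp
        (((√(n : ℝ))⁻¹ * cyclicSum g h d n x : ℝ) * Complex.I)
        ∂(Measure.infinitePi fun _ : ℕ => P)) atTop
      (𝓝 (Complex.exp ((-(windowVar P g h d / 2) : ℝ) : ℂ))) := by
  refine tendsto_of_tendsto_of_dist (tendsto_charFun_windowSum hgh d) ?_
  have hs : Tendsto (fun n : ℕ => (√(n : ℝ))⁻¹ *
      (d * (d * (2 * ∫ z, |h z.1 z.2| ∂(P.prod P))))) atTop (𝓝 0) := by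
    have := (tendsto_inv_atTop_zero.comp
      (Real.tendsto_sqrt_atTop.comp tendsto_natCast_atTop_atTop)).mul_const
      ((d : ℝ) * (d * (2 * ∫ z, |h z.1 z.2| ∂(P.prod P))))
    simpa using this
  refine squeeze_zero' (Eventually.of_forall fun _ => dist_nonneg) ?_ hs
  filter_upwards [eventually_gt_atTop d] with n hn
  obtain ⟨hi, hle⟩ := integral_abs_cyclicSum_sub_le hgh hn
  have hmC := measurable_cyclicSum hgh d n
  have hmW : Measurable fun x : ℕ → E => ∑ i ∈ Finset.range n, windowSum g h d i x :=
    Finset.measurable_sum _ fun k _ => measurable_windowSum hgh d k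
  rw [dist_comm, dist_eq_norm]
  refine (norm_charFun_sub_le (hmC.const_mul _).aemeasurable (hmW.const_mul _).aemeasurable
    (by simpa only [mul_sub] using hi.const_mul (√(n : ℝ))⁻¹)).trans ?_
  simp_rw [← mul_sub, abs_mul]
  rw [integral_const_mul, abs_of_nonneg (by positivity : (0 : ℝ) ≤ (√(n : ℝ))⁻¹)]
  gcongr

end Cyclic

/-! ### Projections of the pair and the Gaussian limit -/

section Statistic

variable {q r : ℕ}

lemma integral_empiricalMeasure {F : Type*} [NormedAddCommGroup F] [NormedSpace ℝ F]
    [CompleteSpace F] (n : ℕ) (x : ℕ → EuclideanSpace ℝ (Fin q))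
    (φ : EuclideanSpace ℝ (Fin q) → F) :
    ∫ y, φ y ∂(empiricalMeasure n x) = (n : ℝ)⁻¹ • ∑ i ∈ Finset.range n, φ (x i) := by
  rw [empiricalMeasure, integral_smul_measure, integral_finsetSum_measure]
  · simp [integral_dirac]
  · exact fun i _ => integrable_dirac (by simp)

/-- The pair formed by the linear part and the incomplete quadratic part. -/
noncomputable def statistic (P : Measure (EuclideanSpace ℝ (Fin q)))
    (f : EuclideanSpace ℝ (Fin q) → EuclideanSpace ℝ (Fin r)) (d n : ℕ)
    (x : ℕ → EuclideanSpace ℝ (Fin q)) : EuclideanSpace ℝ (Fin r) × EuclideanSpace ℝ (Fin r) :=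
  (√(n : ℝ) • ∫ y, hoeffding₁ P f y ∂(empiricalMeasure n x),
    √((n : ℝ) * (d : ℝ)) • incompleteRemainder P f n d x)

variable {P : Measure (EuclideanSpace ℝ (Fin q))} [IsProbabilityMeasure P]
  {f : EuclideanSpace ℝ (Fin q) → EuclideanSpace ℝ (Fin r)}

lemma measurable_statistic (hf : Measurable f) (d n : ℕ) : Measurable (statistic P f d n) := by
  have h1 := measurable_hoeffding₁ (P := P) hf
  have h2 : ∀ i j : ℕ, Measurable fun x : ℕ → EuclideanSpace ℝ (Fin q) =>
      hoeffding₂ P f (x i) (x j) := fun i j =>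
    (measurable_hoeffding₂ (P := P) hf).comp (g := Function.uncurry (hoeffding₂ P f))
      (f := fun x : ℕ → EuclideanSpace ℝ (Fin q) => (x i, x j)) (by fun_prop)
  unfold statistic incompleteRemainder
  simp_rw [integral_empiricalMeasure]
  fun_prop

omit [IsProbabilityMeasure P] in
lemma inner_statistic (d n : ℕ) (x : ℕ → EuclideanSpace ℝ (Fin q))
    (t : WithLp 2 (EuclideanSpace ℝ (Fin r) × EuclideanSpace ℝ (Fin r))) :
    ⟪WithLp.toLp 2 (statistic P f d n x), t⟫ = (√(n : ℝ))⁻¹ *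
      cyclicSum (fun x => ⟪hoeffding₁ P f x, t.fst⟫)
        (fun x y => (√(d : ℝ))⁻¹ * ⟪hoeffding₂ P f x y, t.snd⟫) d n x := by
  -- Used for `a = n` and `a = n d`; it also holds at `0` with `0⁻¹ = 0`.
  have hsq : ∀ a : ℝ, √a * a⁻¹ = (√a)⁻¹ := fun a => by
    rw [← div_eq_mul_inv, Real.sqrt_div_self', one_div]
  rw [WithLp.prod_inner_apply]
  simp only [statistic, incompleteRemainder, integral_empiricalMeasure, smul_smul, hsq,
    real_inner_smul_left, sum_inner, cyclicSum, Finset.sum_add_distrib, mul_add,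
    ← Finset.mul_sum]
  rw [Real.sqrt_mul (Nat.cast_nonneg n), mul_inv, mul_assoc]
  rfl

lemma charFun_limit (hf : Measurable f)
    (hf2 : Integrable (fun p : EuclideanSpace ℝ (Fin q) × EuclideanSpace ℝ (Fin q) =>
      ‖f (p.1 - p.2)‖ ^ 2) (P.prod P)) {d : ℕ} (hd : 1 ≤ d)
    (t : WithLp 2 (EuclideanSpace ℝ (Fin r) × EuclideanSpace ℝ (Fin r))) :
    charFun (((multivariateGaussian 0 (Γ₁ P f)).prod (multivariateGaussian 0 (Γ₂ P f))).map
      (WithLp.toLp 2)) t =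
      Complex.exp ((-(windowVar P (fun x => ⟪hoeffding₁ P f x, t.fst⟫)
        (fun x y => (√(d : ℝ))⁻¹ * ⟪hoeffding₂ P f x y, t.snd⟫) d / 2) : ℝ) : ℂ) := by
  rw [charFun_prod, Γ₁, charFun_multivariateGaussian (posSemidef_covMatrix (memLp_hoeffding₁ hf hf2)),
    Γ₂, charFun_multivariateGaussian (posSemidef_covMatrix (memLp_hoeffding₂ hf hf2)),
    windowVar_inner hf hf2 _ _ hd, ← Complex.exp_add]
  rw [Γ₁, Γ₂]
  congr 1
  simp only [inner_zero_right, Complex.ofReal_zero, zero_mul, zero_sub, WithLp.fst, WithLp.snd]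
  push_cast
  ring

/-- The `L²` product norm supplies the inner product that characteristic functions require; the
plain product carries the sup norm. -/
lemma tendstoInDistribution_toLp_statistic {Ω : Type*} [MeasurableSpace Ω] {μ : Measure Ω}
    [IsProbabilityMeasure μ] {Y : Ω → ℕ → EuclideanSpace ℝ (Fin q)}
    (hY : HasLaw Y (Measure.infinitePi fun _ : ℕ => P) μ) (hf : Measurable f)
    (hf2 : Integrable (fun p : EuclideanSpace ℝ (Fin q) × EuclideanSpace ℝ (Fin q) =>
      ‖f (p.1 - p.2)‖ ^ 2) (P.prod P)) {d : ℕ} (hd : 1 ≤ d) :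
    TendstoInDistribution (fun n ω => WithLp.toLp 2 (statistic P f d n (Y ω))) atTop
      (WithLp.toLp 2) (fun _ => μ)
      ((multivariateGaussian 0 (Γ₁ P f)).prod (multivariateGaussian 0 (Γ₂ P f))) where
  forall_aemeasurable n := (WithLp.measurable_toLp 2 _).comp_aemeasurable
    ((measurable_statistic hf d n).comp_aemeasurable hY.aemeasurable)
  aemeasurable_limit := by fun_prop
  tendsto := by
    refine ProbabilityMeasure.tendsto_of_tendsto_charFun fun t => ?_
    simp only [ProbabilityMeasure.coe_mk]
    rw [charFun_limit hf hf2 hd]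
    have hgh := degeneratePair_inner hf hf2 t.fst t.snd (√(d : ℝ))⁻¹
    refine (tendsto_charFun_cyclicSum hgh d).congr fun n => ?_
    have hm := (measurable_statistic (P := P) hf d n)
    have hmY : AEMeasurable (fun ω => WithLp.toLp 2 (statistic P f d n (Y ω))) μ :=
      (WithLp.measurable_toLp 2 _).comp_aemeasurable (hm.comp_aemeasurable hY.aemeasurable)
    rw [charFun_apply, integral_map hmY (by fun_prop)]
    simp_rw [inner_statistic]
    have hmc := measurable_cyclicSum hgh d n
    exact (hY.integral_comp (f := fun x => Complex.exp (((√(n : ℝ))⁻¹ * cyclicSum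
      (fun x => ⟪hoeffding₁ P f x, t.fst⟫)
      (fun x y => (√(d : ℝ))⁻¹ * ⟪hoeffding₂ P f x y, t.snd⟫) d n x : ℝ) * Complex.I))
      (Measurable.aestronglyMeasurable (by fun_prop))).symm

end Statistic

end IncompleteU

theorem mainTheorem4 {Ω : Type*} [MeasurableSpace Ω] (μ : Measure Ω) [IsProbabilityMeasure μ]
    {q r : ℕ} (P : Measure (EuclideanSpace ℝ (Fin q))) [IsProbabilityMeasure P]
    (X : ℕ → Ω → EuclideanSpace ℝ (Fin q))
    (hX_law : ∀ i, HasLaw (X i) P μ) (hX_indep : iIndepFun X μ)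
    (f : EuclideanSpace ℝ (Fin q) → EuclideanSpace ℝ (Fin r)) (hf : Measurable f)
    (hf2 : Integrable (fun p : EuclideanSpace ℝ (Fin q) × EuclideanSpace ℝ (Fin q) =>
      ‖f (p.1 - p.2)‖ ^ 2) (P.prod P))
    (d : ℕ) (hd : 1 ≤ d) :
    TendstoInDistribution
      (fun (n : ℕ) (ω : Ω) =>
        (√(n : ℝ) • ∫ x, IncompleteU.hoeffding₁ P f x
            ∂(IncompleteU.empiricalMeasure n (fun i => X i ω)),
          √((n : ℝ) * (d : ℝ)) • IncompleteU.incompleteRemainder P f n d (fun i => X i ω)))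
      atTop
      (id : EuclideanSpace ℝ (Fin r) × EuclideanSpace ℝ (Fin r) →
        EuclideanSpace ℝ (Fin r) × EuclideanSpace ℝ (Fin r))
      (fun _ => μ)
      ((multivariateGaussian 0 (IncompleteU.Γ₁ P f)).prod
        (multivariateGaussian 0 (IncompleteU.Γ₂ P f))) := by
  have hY := hX_indep.hasLaw_infinitePi hX_law
    (aemeasurable_pi_lambda _ fun i => (hX_law i).aemeasurable)
  -- The change back to the plain product is a continuous mapping.
  exact (IncompleteU.tendstoInDistribution_toLp_statistic hY hf hf2 hd).continuous_comp
    (WithLp.prod_continuous_ofLp 2 _ _)
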